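/- Let $n\in\mathbb N$, $T>0$, $\Omega=(0,T)\times\mathbb R^n$, let $H\in C^1([0,T]\times\mathbb R^n)$, and let $\sigma\in C^1(\mathbb R^n)$ be convex, with Fenchel conjugate $\sigma^*(p)=\sup_{y\in\mathbb R^n}\{\langle p,y\rangle-\sigma(y)\}\in(-\infty,+\infty]$. For $t\in[0,T)$ and $x,q\in\mathbb R^n$ put $$\varphi(t,x,q)=\langle x,q\rangle-\sigma^*(q)-\int_0^tH(\tau,q)\,d\tau\in[-\infty,+\infty),\qquad u(t,x)=\max_{q\in\mathbb R^n}\varphi(t,x,q),$$ the function $u$ being the Hopf-type formula for the Cauchy problem $u_t+H(t,D_xu)=0$ in $\Omega$, $u(0,\cdot)=\sigma$. A point $(t,x)\in\Omega$ is called singular if $u$ is not differentiable at $(t,x)$ (as a function of both variables). Let $B'(x,r)$ denote the closed Euclidean ball of centre $x$ and radius $r$. Assume: (A1) For every $(t_0,x_0)\in[0,T)\times\mathbb R^n$ there are $r,N>0$ such that $\varphi(t,x,p)<\max_{|q|\le N}\varphi(t,x,q)$ whenever $(t,x)\in[0,T)\times\mathbb R^n$, $|t-t_0|+|x-x_0|<r$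 and $|p|>N$. (This ensures that the maximum defining $u$ is attained and finite.) (A2) Either $H(t,\cdot)$ is convex for all $t\in(0,T)$, or $H(t,\cdot)$ is concave for all $t\in(0,T)$, or $H(t,p)=g(t)h(p)+k(t)$ for all $t\in(0,T)$, $p\in\mathbb R^n$ with some functions $g,h,k$ such that $g\ge0$ on $(0,T)$ or $g\le0$ on $(0,T)$. Assume moreover that $\sigma$ is Lipschitz on $\mathbb R^n$. Then for each $\varepsilon>0$ there exists $\delta>0$ such that for every singular point $(t_0,x_0)\in\Omega$ and every $t_1\in[t_0,t_0+\delta]$ with $t_1<T$ there exists $x_1\in B'(x_0,\varepsilon)$ such that $(t_1,x_1)$ is also a singular point. -/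

import Mathlib

namespace HopfFormula

noncomputable section

/-- The Fenchel conjugate `σ*(p) = sup_y (⟨p, y⟩ - σ(y))`, with values in `(-∞, +∞]`. -/
def conj {n : ℕ} (σ : EuclideanSpace ℝ (Fin n) → ℝ) (p : EuclideanSpace ℝ (Fin n)) : EReal :=
  ⨆ y : EuclideanSpace ℝ (Fin n), ((inner ℝ p y - σ y : ℝ) : EReal)

/-- `φ(t, x, q) = ⟨x, q⟩ - σ*(q) - ∫₀ᵗ H(τ, q) dτ`, which is `-∞` when `q` lies outside the
effective domain of `σ*`. -/
def phi {n : ℕ} (H : ℝ → EuclideanSpace ℝ (Fin n) → ℝ) (σ : EuclideanSpace ℝ (Fin n) → ℝ)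
    (t : ℝ) (x q : EuclideanSpace ℝ (Fin n)) : EReal :=
  ((inner ℝ x q : ℝ) : EReal) - conj σ q - ((∫ τ in (0 : ℝ)..t, H τ q : ℝ) : EReal)

/-- The Hopf-type formula `u(t, x) = max_q φ(t, x, q)`. Under condition `A1` the supremum is
finite and attained at each `(t, x)` with `0 ≤ t < T`. -/
def hopf {n : ℕ} (H : ℝ → EuclideanSpace ℝ (Fin n) → ℝ) (σ : EuclideanSpace ℝ (Fin n) → ℝ)
    (t : ℝ) (x : EuclideanSpace ℝ (Fin n)) : ℝ :=
  (⨆ q : EuclideanSpace ℝ (Fin n), phi H σ t x q).toReal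

/-- The compatibility condition (A1). The supremum over the closed ball is a maximum, since
`φ(t, x, ·)` is upper semicontinuous and the ball is compact. -/
def A1 {n : ℕ} (T : ℝ) (H : ℝ → EuclideanSpace ℝ (Fin n) → ℝ)
    (σ : EuclideanSpace ℝ (Fin n) → ℝ) : Prop :=
  ∀ t₀ ∈ Set.Ico 0 T, ∀ x₀ : EuclideanSpace ℝ (Fin n), ∃ r > (0 : ℝ), ∃ N > (0 : ℝ),
    ∀ t ∈ Set.Ico 0 T, ∀ x : EuclideanSpace ℝ (Fin n), |t - t₀| + ‖x - x₀‖ < r →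
      ∀ p : EuclideanSpace ℝ (Fin n), N < ‖p‖ →
        phi H σ t x p < ⨆ q ∈ Metric.closedBall (0 : EuclideanSpace ℝ (Fin n)) N, phi H σ t x q

/-- The structural condition (A2) on the Hamiltonian: `H(t, ·)` is convex for all `t ∈ (0, T)`,
or concave for all `t ∈ (0, T)`, or `H(t, p) = g(t) h(p) + k(t)` where `g` does not change
its sign on `(0, T)`. -/
def A2 {n : ℕ} (T : ℝ) (H : ℝ → EuclideanSpace ℝ (Fin n) → ℝ) : Prop :=
  ((∀ t ∈ Set.Ioo 0 T, ConvexOn ℝ Set.univ (H t)) ∨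
    (∀ t ∈ Set.Ioo 0 T, ConcaveOn ℝ Set.univ (H t))) ∨
  ∃ (g : ℝ → ℝ) (h : EuclideanSpace ℝ (Fin n) → ℝ) (k : ℝ → ℝ),
    (∀ t ∈ Set.Ioo 0 T, ∀ p, H t p = g t * h p + k t) ∧
    ((∀ t ∈ Set.Ioo 0 T, 0 ≤ g t) ∨ (∀ t ∈ Set.Ioo 0 T, g t ≤ 0))

/-- `(t, x)` is a singular point of `u`: it lies in `Ω = (0, T) × ℝⁿ` and `u` is not (jointly)
differentiable there. -/
def IsSingular {n : ℕ} (T : ℝ) (H : ℝ → EuclideanSpace ℝ (Fin n) → ℝ)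
    (σ : EuclideanSpace ℝ (Fin n) → ℝ) (t : ℝ) (x : EuclideanSpace ℝ (Fin n)) : Prop :=
  t ∈ Set.Ioo 0 T ∧
    ¬ DifferentiableAt ℝ (fun z : ℝ × EuclideanSpace ℝ (Fin n) => hopf H σ z.1 z.2) (t, x)

end

end HopfFormula

open Set Filter Topology

namespace HopfFormula

noncomputable section

variable {E : Type*} [NormedAddCommGroup E] [InnerProductSpace ℝ E]

/-! Suppose `u(t₁, ·)` has no singular point in the closed ball `B` of radius `ε` about `x₀`. It is
enough to find a characteristic that starts at `(t₀, x₀)`, reaches `(t₁, x₁)` with `x₁` inside `B`,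
and carries `q = D_x u(t₁, x₁)`, so that `x₁ = x₀ + ∫ D τ q` over `[t₀, t₁]`, where `D` is the
spatial gradient of `H`. This implicit equation is solved variationally: in
`exists_subgradient_eq_add_gradient` it is the first-order condition for minimizing a convex
conjugate minus a differentiable function. The Lipschitz constant `K` of `σ` bounds every momentum
in the domain of `σ*`, hence the speeds, so `δ` depends on `ε` but not on `(t₀, x₀)`.

Every maximizer of `φ(t₁, x₁, ·)` is a subgradient of `u(t₁, ·)` at `x₁`, so differentiability there
leaves `q` as the only one. Uniqueness moves back to `(t₀, x₀)` by `IsMaximizer.backward`: (A2)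
gives the Bregman remainder of `H(τ, ·)` between two given points a sign constant in `τ`, and
differentiability of `σ` makes the subgradient inequality for `σ*` strict. A unique maximizer makes
`u` differentiable at `(t₀, x₀)` by Danskin's argument, a contradiction. -/

/-- The effective domain of the Fenchel conjugate of `σ`. -/
def effDomain (σ : E → ℝ) : Set E := {p | BddAbove (range fun y => inner ℝ p y - σ y)}

/-- The Fenchel conjugate of `σ` as a real function, meaningful on `effDomain σ`. -/
def realConj (σ : E → ℝ) (p : E) : ℝ := ⨆ y, (inner ℝ p y - σ y)

/-- The real version of `phi`, meaningful for `q ∈ effDomain σ`; here `G` stands for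
`∫₀ᵗ H(τ, ·) dτ`. -/
def objective (σ G : E → ℝ) (x q : E) : ℝ := inner ℝ x q - realConj σ q - G q

/-- `q` maximizes `objective σ G x` over the effective domain. -/
def IsMaximizer (σ G : E → ℝ) (x q : E) : Prop :=
  q ∈ effDomain σ ∧ ∀ p ∈ effDomain σ, objective σ G x p ≤ objective σ G x q

/-! ### Fenchel conjugates, subgradients and first-order conditions. -/

theorem inner_sub_le_realConj {σ : E → ℝ} {p : E} (hp : p ∈ effDomain σ) (y : E) :
    inner ℝ p y - σ y ≤ realConj σ p :=
  le_ciSup (f := fun y => inner ℝ p y - σ y) hp y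

theorem convexOn_realConj (σ : E → ℝ) : ConvexOn ℝ (effDomain σ) (realConj σ) := by
  have key : ∀ p ∈ effDomain σ, ∀ q ∈ effDomain σ, ∀ a b : ℝ, 0 ≤ a → 0 ≤ b → a + b = 1 →
      ∀ y, inner ℝ (a • p + b • q) y - σ y ≤ a * realConj σ p + b * realConj σ q := by
    intro p hp q hq a b ha hb hab y
    have h1 := mul_le_mul_of_nonneg_left (inner_sub_le_realConj hp y) ha
    have h2 := mul_le_mul_of_nonneg_left (inner_sub_le_realConj hq y) hb
    rw [inner_add_left, real_inner_smul_left, real_inner_smul_left]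
    have : σ y = a * σ y + b * σ y := by rw [← add_mul, hab, one_mul]
    linarith
  constructor
  · intro p hp q hq a b ha hb hab
    exact ⟨_, by rintro _ ⟨y, rfl⟩; exact key p hp q hq a b ha hb hab y⟩
  · intro p hp q hq a b ha hb hab
    exact ciSup_le fun y => key p hp q hq a b ha hb hab y

/-- Along `y = r • p` the quantity `⟨p, y⟩ - σ y` grows at least like `r ‖p‖ (‖p‖ - K)`, which is
unbounded when `‖p‖ > K`. This supplies the compactness used for all maximizers. -/
theorem norm_le_of_mem_effDomain {σ : E → ℝ} {K : NNReal} (hσ : LipschitzWith K σ) {p : E}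
    (hp : p ∈ effDomain σ) : ‖p‖ ≤ K := by
  by_contra! hlt
  have hp0 : 0 < ‖p‖ := lt_of_le_of_lt K.2 hlt
  have hpos : 0 < ‖p‖ * (‖p‖ - K) := mul_pos hp0 (sub_pos.2 hlt)
  obtain ⟨r, hr⟩ := exists_nat_gt ((realConj σ p + σ 0) / (‖p‖ * (‖p‖ - K)))
  rw [div_lt_iff₀ hpos] at hr
  have h1 := inner_sub_le_realConj hp ((r : ℝ) • p)
  have h2 := hσ.dist_le_mul ((r : ℝ) • p) 0
  rw [Real.dist_eq, dist_zero_right, norm_smul, Real.norm_natCast] at h2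
  rw [real_inner_smul_right, real_inner_self_eq_norm_sq] at h1
  nlinarith [le_abs_self (σ ((r : ℝ) • p) - σ 0)]

/-- If `s * a` dominates the increments of a function along `(0, 1]`, then `a` dominates its
derivative at `0`. -/
theorem le_of_hasDerivAt_of_le_mul {ψ : ℝ → ℝ} {d a : ℝ} (hψ : HasDerivAt ψ d 0)
    (h : ∀ s, 0 < s → s ≤ 1 → ψ s - ψ 0 ≤ s * a) : d ≤ a := by
  have h1 := (hasDerivAt_iff_tendsto_slope.1 hψ).mono_left
    (nhdsWithin_mono 0 (fun s (hs : s ∈ Ioi (0 : ℝ)) => ne_of_gt hs))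
  refine le_of_tendsto h1 ?_
  filter_upwards [Ioc_mem_nhdsGT (zero_lt_one' ℝ)] with s hs
  rw [slope_def_field, sub_zero, div_le_iff₀ hs.1, mul_comm]
  exact h s hs.1 hs.2

theorem hasDerivAt_comp_segment {G : E → ℝ} {g q : E} (hG : HasFDerivAt G (innerSL ℝ g) q)
    (v : E) : HasDerivAt (fun s : ℝ => G (q + s • v)) (inner ℝ g v) 0 := by
  have h1 : HasDerivAt (fun s : ℝ => q + s • v) v 0 := by
    simpa using ((hasDerivAt_id (0 : ℝ)).smul_const v).const_add q
  have h2 : HasFDerivAt G (innerSL ℝ g) (q + (0 : ℝ) • v) := by simpa using hG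
  exact h2.comp_hasDerivAt (0 : ℝ) h1

/-- First-order condition for minimizing a convex function minus a differentiable one. -/
theorem convexOn_add_inner_le_of_isMinOn {S : Set E} {f G : E → ℝ} {g q : E}
    (hf : ConvexOn ℝ S f) (hq : q ∈ S) (hG : HasFDerivAt G (innerSL ℝ g) q)
    (hmin : ∀ p ∈ S, f q - G q ≤ f p - G p) {p : E} (hp : p ∈ S) :
    f q + inner ℝ g (p - q) ≤ f p := by
  have := le_of_hasDerivAt_of_le_mul (hasDerivAt_comp_segment hG (p - q)) (a := f p - f q) ?_
  · linarith
  intro s hs0 hs1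
  have he : q + s • (p - q) = (1 - s) • q + s • p := by
    rw [smul_sub, sub_smul, one_smul]; abel
  have hmem : q + s • (p - q) ∈ S := by
    rw [he]; exact hf.1 hq hp (by linarith) hs0.le (by ring)
  have h1 := hmin _ hmem
  have h2 := hf.2 hq hp (by linarith : 0 ≤ 1 - s) hs0.le (by ring)
  rw [← he, smul_eq_mul, smul_eq_mul] at h2
  simp only [zero_smul, add_zero]
  linarith

theorem convexOn_add_inner_le {f : E → ℝ} {g q : E} (hf : ConvexOn ℝ univ f)
    (hg : HasFDerivAt f (innerSL ℝ g) q) (p : E) : f q + inner ℝ g (p - q) ≤ f p :=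
  convexOn_add_inner_le_of_isMinOn hf (mem_univ q) hg (fun p _ => by simp) (mem_univ p)

/-- A local subgradient at a point of differentiability is the gradient. -/
theorem eq_of_hasFDerivAt_of_eventually_le {f : E → ℝ} {g p y : E}
    (hg : HasFDerivAt f (innerSL ℝ g) y)
    (h : ∀ᶠ z in 𝓝 y, f y + inner ℝ p (z - y) ≤ f z) : p = g := by
  have h1 : HasFDerivAt (fun z => f z - innerSL ℝ p z) (innerSL ℝ g - innerSL ℝ p) y :=
    hg.sub (innerSL ℝ p).hasFDerivAt
  have h2 : IsLocalMin (fun z => f z - innerSL ℝ p z) y := by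
    filter_upwards [h] with z hz
    rw [inner_sub_right] at hz
    simp only [innerSL_apply_apply]
    linarith
  have h3 := h2.hasFDerivAt_eq_zero h1
  have h4 := DFunLike.congr_fun h3 (g - p)
  simp only [sub_apply, innerSL_apply_apply,
    zero_apply, ← inner_sub_left] at h4
  exact (sub_eq_zero.1 (inner_self_eq_zero.1 h4)).symm

theorem gradient_mem_effDomain {σ : E → ℝ} {g y : E} (hσ : ConvexOn ℝ univ σ)
    (hg : HasFDerivAt σ (innerSL ℝ g) y) :
    g ∈ effDomain σ ∧ realConj σ g = inner ℝ g y - σ y := by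
  have h : ∀ z, inner ℝ g z - σ z ≤ inner ℝ g y - σ y := fun z => by
    have := convexOn_add_inner_le hσ hg z
    rw [inner_sub_right] at this
    linarith
  have hmem : g ∈ effDomain σ := ⟨_, by rintro _ ⟨z, rfl⟩; exact h z⟩
  exact ⟨hmem, le_antisymm (ciSup_le h) (inner_sub_le_realConj hmem y)⟩

theorem eq_gradient_of_realConj_le {σ : E → ℝ} {g p y : E}
    (hg : HasFDerivAt σ (innerSL ℝ g) y) (hp : p ∈ effDomain σ)
    (h : realConj σ p ≤ inner ℝ p y - σ y) : p = g := by
  refine eq_of_hasFDerivAt_of_eventually_le hg (Eventually.of_forall fun z => ?_)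
  have := inner_sub_le_realConj hp z
  rw [inner_sub_right]
  linarith

theorem hasFDerivAt_innerSL_of_differentiableAt [CompleteSpace E] {f : E → ℝ} {x : E}
    (hf : DifferentiableAt ℝ f x) : ∃ g : E, HasFDerivAt f (innerSL ℝ g) x := by
  refine ⟨(InnerProductSpace.toDual ℝ E).symm (fderiv ℝ f x), ?_⟩
  convert hf.hasFDerivAt using 1
  ext v
  simp

/-! ### Maximizers: strictness, backward transport, existence. -/

/-- The conjugate is strictly above its supporting hyperplane given by the first-order
condition at a maximizer. -/
theorem IsMaximizer.realConj_lt [CompleteSpace E] {σ G : E → ℝ} {x q g : E}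
    (hσ : ConvexOn ℝ univ σ) (hdiff : Differentiable ℝ σ) (hq : IsMaximizer σ G x q)
    (hG : HasFDerivAt G (innerSL ℝ g) q) {p : E} (hp : p ∈ effDomain σ) (hpq : p ≠ q) :
    realConj σ q + inner ℝ (x - g) (p - q) < realConj σ p := by
  have hG' : HasFDerivAt (fun p => innerSL ℝ x p - G p) (innerSL ℝ (x - g)) q := by
    rw [map_sub]; exact (innerSL ℝ x).hasFDerivAt.sub hG
  have hsub : ∀ p ∈ effDomain σ, realConj σ q + inner ℝ (x - g) (p - q) ≤ realConj σ p := by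
    intro p hp
    refine convexOn_add_inner_le_of_isMinOn (convexOn_realConj σ) hq.1 hG' (fun p hp => ?_) hp
    have := hq.2 p hp
    simp only [objective] at this
    simp only [innerSL_apply_apply]
    linarith
  -- Fenchel equality holds at `w`, the gradient of `σ` at `x - g`. Testing the subgradient
  -- inequality there forces Fenchel equality at `q`. A point `p` giving equality would satisfy it
  -- too, and then both would equal `w`.
  obtain ⟨w, hw⟩ := hasFDerivAt_innerSL_of_differentiableAt (hdiff (x - g))
  obtain ⟨hwmem, hwval⟩ := gradient_mem_effDomain hσ hw
  have hqval : realConj σ q ≤ inner ℝ q (x - g) - σ (x - g) := by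
    have h := hsub w hwmem
    rw [inner_sub_right, real_inner_comm, real_inner_comm q] at h
    linarith
  refine lt_of_le_of_ne (hsub p hp) fun heq => hpq ?_
  rw [eq_gradient_of_realConj_le hw hq.1 hqval]
  refine eq_gradient_of_realConj_le hw hp ?_
  rw [← heq, inner_sub_right, real_inner_comm, real_inner_comm q]
  linarith

/-- Unique maximizers persist backwards along characteristics. -/
theorem IsMaximizer.backward [CompleteSpace E] {σ G₀ G₁ : E → ℝ} {x₀ x₁ q g₀ g₁ : E}
    (hσ : ConvexOn ℝ univ σ) (hdiff : Differentiable ℝ σ) (hq : IsMaximizer σ G₁ x₁ q)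
    (hG : HasFDerivAt G₁ (innerSL ℝ g₁) q) (hx : x₀ = x₁ - (g₁ - g₀))
    (huniq : ∀ p ∈ effDomain σ, p ≠ q → objective σ G₁ x₁ p < objective σ G₁ x₁ q)
    (hsign : ∀ p, 0 ≤ G₀ p - G₀ q - inner ℝ g₀ (p - q) ∨
      G₁ p - G₁ q - inner ℝ g₁ (p - q) ≤ G₀ p - G₀ q - inner ℝ g₀ (p - q))
    {p : E} (hp : p ∈ effDomain σ) (hpq : p ≠ q) :
    objective σ G₀ x₀ p < objective σ G₀ x₀ q := by
  have h1 := huniq p hp hpq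
  have h2 := hq.realConj_lt hσ hdiff hG hp hpq
  simp only [objective] at h1 ⊢
  subst hx
  simp only [inner_sub_left, inner_sub_right] at h2 hsign ⊢
  -- Since `x₀ - g₀ = x₁ - g₁`, the objective increments from `q` to `p` at both times are the same
  -- negative quantity (by `h2`) minus the respective remainder. Either the remainder of `G₀` is
  -- nonnegative, or it is at least that of `G₁` and `h1` applies.
  rcases hsign p with h3 | h3 <;> linarith

/-- As an `EReal`-valued supremum of continuous functions the conjugate is lower semicontinuous, so
it attains its minimum on a compact set; the finite value at `p₀` forces the minimizer into the
effective domain. -/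
theorem exists_isMinOn_of_mem_effDomain {σ c : E → ℝ} {C : Set E} (hC : IsCompact C)
    (hc : Continuous c) {p₀ : E} (hp₀ : p₀ ∈ C) (hp₀' : p₀ ∈ effDomain σ) :
    ∃ q ∈ C, q ∈ effDomain σ ∧
      ∀ p ∈ C, p ∈ effDomain σ → realConj σ q + c q ≤ realConj σ p + c p := by
  let ρ : E → EReal := fun q => ⨆ y : E, ((inner ℝ q y - σ y + c q : ℝ) : EReal)
  have hρ : LowerSemicontinuous ρ := by
    refine lowerSemicontinuous_iSup fun y => Continuous.lowerSemicontinuous ?_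
    exact continuous_coe_real_ereal.comp (by fun_prop)
  have hρle : ∀ p ∈ effDomain σ, ρ p ≤ ((realConj σ p + c p : ℝ) : EReal) := fun p hp =>
    iSup_le fun y => EReal.coe_le_coe_iff.2 (by linarith [inner_sub_le_realConj hp y])
  obtain ⟨q, hqC, hq⟩ := (hρ.lowerSemicontinuousOn C).exists_isMinOn ⟨p₀, hp₀⟩ hC
  have hle : ∀ p ∈ C, p ∈ effDomain σ → ∀ y, inner ℝ q y - σ y ≤ realConj σ p + c p - c q := by
    intro p hp hp' y
    have h1 : ((inner ℝ q y - σ y + c q : ℝ) : EReal) ≤ ((realConj σ p + c p : ℝ) : EReal) :=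
      (le_iSup (fun y : E => ((inner ℝ q y - σ y + c q : ℝ) : EReal)) y).trans
        ((hq hp).trans (hρle p hp'))
    have := EReal.coe_le_coe_iff.1 h1
    linarith
  refine ⟨q, hqC, ⟨_, by rintro _ ⟨y, rfl⟩; exact hle p₀ hp₀ hp₀' y⟩, fun p hp hp' => ?_⟩
  have : realConj σ q ≤ realConj σ p + c p - c q := ciSup_le (hle p hp hp')
  linarith

theorem exists_isMaximizer [ProperSpace E] {σ G : E → ℝ} {K : NNReal}
    (hσ : ConvexOn ℝ univ σ) (hdiff : Differentiable ℝ σ) (hLip : LipschitzWith K σ)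
    (hG : Continuous G) (x : E) : ∃ q, IsMaximizer σ G x q := by
  obtain ⟨w, hw⟩ := hasFDerivAt_innerSL_of_differentiableAt (hdiff 0)
  have hwmem := (gradient_mem_effDomain hσ hw).1
  have hball : ∀ p ∈ effDomain σ, p ∈ Metric.closedBall (0 : E) K := fun p hp => by
    simpa using norm_le_of_mem_effDomain hLip hp
  obtain ⟨q, -, hq, hmin⟩ := exists_isMinOn_of_mem_effDomain (σ := σ)
    (c := fun q => G q - inner ℝ x q) (isCompact_closedBall (0 : E) K) (by fun_prop)
    (hball w hwmem) hwmem
  refine ⟨q, hq, fun p hp => ?_⟩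
  have := hmin p (hball p hp) hp
  simp only [objective]
  linarith

/-! ### From the extended-valued formula to real objectives. -/

theorem conj_eq_coe {n : ℕ} {σ : EuclideanSpace ℝ (Fin n) → ℝ} {p : EuclideanSpace ℝ (Fin n)}
    (hp : p ∈ effDomain σ) : conj σ p = (realConj σ p : EReal) := by
  refine le_antisymm (iSup_le fun y => EReal.coe_le_coe_iff.2 (inner_sub_le_realConj hp y)) ?_
  have hbot : conj σ p ≠ ⊥ := fun h => by
    have := le_iSup (fun y => ((inner ℝ p y - σ y : ℝ) : EReal)) 0
    rw [← conj, h, le_bot_iff] at this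
    exact EReal.coe_ne_bot _ this
  by_cases htop : conj σ p = ⊤
  · rw [htop]; exact le_top
  rw [← EReal.coe_toReal htop hbot, EReal.coe_le_coe_iff]
  refine ciSup_le fun y => ?_
  rw [← EReal.coe_le_coe_iff, EReal.coe_toReal htop hbot]
  exact le_iSup (fun y => ((inner ℝ p y - σ y : ℝ) : EReal)) y

theorem conj_eq_top {n : ℕ} {σ : EuclideanSpace ℝ (Fin n) → ℝ} {p : EuclideanSpace ℝ (Fin n)}
    (hp : p ∉ effDomain σ) : conj σ p = ⊤ := by
  rw [EReal.eq_top_iff_forall_lt]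
  intro a
  by_contra! h
  refine hp ⟨a, ?_⟩
  rintro _ ⟨y, rfl⟩
  exact EReal.coe_le_coe_iff.1
    ((le_iSup (fun y => ((inner ℝ p y - σ y : ℝ) : EReal)) y).trans h)

theorem hopf_eq_of_isMaximizer {n : ℕ} {H : ℝ → EuclideanSpace ℝ (Fin n) → ℝ}
    {σ : EuclideanSpace ℝ (Fin n) → ℝ} {t : ℝ} {x q : EuclideanSpace ℝ (Fin n)}
    (hq : IsMaximizer σ (fun p => ∫ τ in (0 : ℝ)..t, H τ p) x q) :
    hopf H σ t x = objective σ (fun p => ∫ τ in (0 : ℝ)..t, H τ p) x q := by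
  have hphi : ∀ p ∈ effDomain σ, phi H σ t x p =
      (objective σ (fun p => ∫ τ in (0 : ℝ)..t, H τ p) x p : EReal) := fun p hp => by
    simp only [phi, conj_eq_coe hp, objective, EReal.coe_sub]
  have : (⨆ p, phi H σ t x p) =
      (objective σ (fun p => ∫ τ in (0 : ℝ)..t, H τ p) x q : EReal) := by
    refine le_antisymm (iSup_le fun p => ?_) ((hphi q hq.1).symm.le.trans (le_iSup _ q))
    by_cases hp : p ∈ effDomain σ
    · rw [hphi p hp]; exact EReal.coe_le_coe_iff.2 (hq.2 p hp)
    · simp [phi, conj_eq_top hp]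
  rw [hopf, this, EReal.toReal_coe]

/-! ### Time integrals of the Hamiltonian and signs of Bregman remainders. -/

/-- A `C¹` Hamiltonian on `[0, T] × E` extends continuously in time to `ℝ × E`, together with
its spatial gradient. -/
theorem exists_hamiltonian_extension [CompleteSpace E] {T : ℝ} (hT : 0 < T) {H : ℝ → E → ℝ}
    (hH : ContDiffOn ℝ 1 (fun z : ℝ × E => H z.1 z.2) (Icc 0 T ×ˢ univ)) :
    ∃ (J : ℝ → E → ℝ) (D : ℝ → E → E), Continuous (Function.uncurry J) ∧
      Continuous (Function.uncurry D) ∧ (∀ τ q, HasFDerivAt (J τ) (innerSL ℝ (D τ q)) q) ∧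
      ∀ τ ∈ Icc 0 T, J τ = H τ := by
  set f : ℝ × E → ℝ := fun z => H z.1 z.2
  set S : Set (ℝ × E) := Icc 0 T ×ˢ univ
  have hS : UniqueDiffOn ℝ S := (uniqueDiffOn_Icc hT).prod uniqueDiffOn_univ
  -- Time is clamped to `[0, T]`, which makes the extension constant in time outside the interval.
  let π : ℝ → ℝ := fun τ => projIcc 0 T hT.le τ
  have hπ : Continuous π := continuous_subtype_val.comp continuous_projIcc
  have hπmem : ∀ τ, π τ ∈ Icc 0 T := fun τ => (projIcc 0 T hT.le τ).2
  have hpair : Continuous fun z : ℝ × E => (π z.1, z.2) :=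
    (hπ.comp continuous_fst).prodMk continuous_snd
  have hmem : ∀ z : ℝ × E, (π z.1, z.2) ∈ S := fun z => ⟨hπmem _, mem_univ _⟩
  let L : ℝ × E → E →L[ℝ] ℝ := fun z =>
    (fderivWithin ℝ f S (π z.1, z.2)).comp (ContinuousLinearMap.inr ℝ ℝ E)
  have hL : Continuous L :=
    ((hH.continuousOn_fderivWithin hS le_rfl).comp_continuous hpair hmem).clm_comp
      continuous_const
  refine ⟨fun τ q => H (π τ) q, fun τ q => (InnerProductSpace.toDual ℝ E).symm (L (τ, q)),
    hH.continuousOn.comp_continuous hpair hmem,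
    (InnerProductSpace.toDual ℝ E).symm.continuous.comp hL, fun τ q => ?_, fun τ hτ => ?_⟩
  · have h1 : HasFDerivWithinAt f (fderivWithin ℝ f S (π τ, q)) S (π τ, q) :=
      (hH.differentiableOn one_ne_zero _ (hmem (τ, q))).hasFDerivWithinAt
    have h2 : HasFDerivWithinAt (fun p : E => (π τ, p)) (ContinuousLinearMap.inr ℝ ℝ E)
        univ q := (hasFDerivAt_prodMk_right (π τ) q).hasFDerivWithinAt
    have h3 := (h1.comp q h2 (fun p _ => hmem (τ, p))).hasFDerivAt univ_mem
    have h4 : innerSL ℝ ((InnerProductSpace.toDual ℝ E).symm (L (τ, q))) =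
        (fderivWithin ℝ f S (π τ, q)).comp (ContinuousLinearMap.inr ℝ ℝ E) := by
      ext v
      rw [innerSL_apply_apply, InnerProductSpace.toDual_symm_apply]
    rw [← h4] at h3
    exact h3
  · funext q
    change H (π τ) q = H τ q
    simp only [π, projIcc_of_mem hT.le hτ]

theorem hasFDerivAt_intervalIntegral [ProperSpace E] {J : ℝ → E → ℝ} {D : ℝ → E → E}
    (hJ : Continuous (Function.uncurry J)) (hD : Continuous (Function.uncurry D))
    (hJD : ∀ τ q, HasFDerivAt (J τ) (innerSL ℝ (D τ q)) q) (a b : ℝ) (q : E) :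
    HasFDerivAt (fun p => ∫ τ in a..b, J τ p) (innerSL ℝ (∫ τ in a..b, D τ q)) q := by
  have hJc : ∀ p, Continuous fun τ => J τ p := fun p =>
    hJ.comp (by fun_prop : Continuous fun τ => (τ, p))
  have hDc : ∀ p, Continuous fun τ => D τ p := fun p =>
    hD.comp (by fun_prop : Continuous fun τ => (τ, p))
  obtain ⟨M, hM⟩ := (isCompact_uIcc.prod (isCompact_closedBall q 1)).exists_bound_of_continuousOn
    (s := uIcc a b ×ˢ Metric.closedBall q 1) hD.continuousOn
  rw [← ContinuousLinearMap.intervalIntegral_comp_comm _ ((hDc q).intervalIntegrable a b)]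
  refine hasFDerivAt_integral_of_dominated_of_fderiv_le''
    (F := fun p τ => J τ p) (F' := fun p τ => innerSL ℝ (D τ p)) (bound := fun _ => M)
    (Metric.closedBall_mem_nhds q one_pos) (.of_forall fun p => ?_)
    ((hJc q).intervalIntegrable a b) ?_ ?_ intervalIntegrable_const
    (.of_forall fun τ p _ => hJD τ p)
  · exact (hJc p).aestronglyMeasurable
  · exact ((innerSL ℝ).continuous.comp (hDc q)).aestronglyMeasurable
  · refine (MeasureTheory.ae_restrict_mem measurableSet_uIoc).mono fun τ hτ p hp => ?_
    rw [innerSL_apply_norm]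
    exact hM (τ, p) ⟨uIoc_subset_uIcc hτ, hp⟩

/-- Under (A2), the Bregman remainder of `H(τ, ·)` between two points keeps its sign in `τ`. -/
theorem A2.bregman_sign {n : ℕ} {T : ℝ} {H J : ℝ → EuclideanSpace ℝ (Fin n) → ℝ}
    {D : ℝ → EuclideanSpace ℝ (Fin n) → EuclideanSpace ℝ (Fin n)} (hA2 : A2 T H)
    (hJD : ∀ τ q, HasFDerivAt (J τ) (innerSL ℝ (D τ q)) q) (hJH : ∀ τ ∈ Icc 0 T, J τ = H τ)
    (p q : EuclideanSpace ℝ (Fin n)) :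
    (∀ τ ∈ Ioo 0 T, 0 ≤ J τ p - J τ q - inner ℝ (D τ q) (p - q)) ∨
      (∀ τ ∈ Ioo 0 T, J τ p - J τ q - inner ℝ (D τ q) (p - q) ≤ 0) := by
  rcases hA2 with (hc | hc) | ⟨g, h, k, hH, hg⟩
  · left
    intro τ hτ
    have h1 := hc τ hτ
    rw [← hJH τ (Ioo_subset_Icc_self hτ)] at h1
    linarith [convexOn_add_inner_le h1 (hJD τ q) p]
  · right
    intro τ hτ
    have h1 := (hc τ hτ).neg
    rw [← hJH τ (Ioo_subset_Icc_self hτ)] at h1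
    have h2 : HasFDerivAt (-J τ) (innerSL ℝ (-D τ q)) q := by
      rw [map_neg]; exact (hJD τ q).neg
    have := convexOn_add_inner_le h1 h2 p
    rw [inner_neg_left, Pi.neg_apply, Pi.neg_apply] at this
    linarith
  · have hval : ∃ β : ℝ, ∀ τ ∈ Ioo 0 T,
        J τ p - J τ q - inner ℝ (D τ q) (p - q) = g τ * β := by
      have hJ : ∀ τ ∈ Ioo 0 T, ∀ p, J τ p = g τ * h p + k τ := fun τ hτ p => by
        rw [hJH τ (Ioo_subset_Icc_self hτ), hH τ hτ]
      have hline : ∀ τ ∈ Ioo 0 T,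
          HasDerivAt (fun s : ℝ => g τ * h (q + s • (p - q)) + k τ)
            (inner ℝ (D τ q) (p - q)) 0 := fun τ hτ => by
        simpa only [hJ τ hτ] using hasDerivAt_comp_segment (hJD τ q) (p - q)
      -- No regularity of `h` is assumed. If `h` has no derivative along the segment at `q`,
      -- differentiability of `J τ` forces `g τ = 0` throughout `(0, T)`, and `β = 0` works.
      by_cases hd : DifferentiableAt ℝ (fun s : ℝ => h (q + s • (p - q))) 0
      · refine ⟨h p - h q - deriv (fun s : ℝ => h (q + s • (p - q))) 0, fun τ hτ => ?_⟩
        rw [(hline τ hτ).unique ((hd.hasDerivAt.const_mul (g τ)).add_const (k τ)),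
          hJ τ hτ, hJ τ hτ]
        ring
      · refine ⟨0, fun τ hτ => ?_⟩
        have hg0 : g τ = 0 := by
          by_contra hne
          refine hd ?_
          have := ((hline τ hτ).sub_const (k τ)).const_mul (g τ)⁻¹
          refine (this.congr_of_eventuallyEq (.of_forall fun s => ?_)).differentiableAt
          field_simp
          ring
        have h0 := hline τ hτ
        simp only [hg0, zero_mul, zero_add] at h0
        rw [h0.unique (hasDerivAt_const 0 (k τ)), hJ τ hτ, hJ τ hτ, hg0]
        ring
    obtain ⟨β, hβ⟩ := hval
    rcases hg with hg | hg <;> rcases le_total 0 β with hb | hb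
    · exact .inl fun τ hτ => by rw [hβ τ hτ]; exact mul_nonneg (hg τ hτ) hb
    · exact .inr fun τ hτ => by rw [hβ τ hτ]; exact mul_nonpos_of_nonneg_of_nonpos (hg τ hτ) hb
    · exact .inr fun τ hτ => by rw [hβ τ hτ]; exact mul_nonpos_of_nonpos_of_nonneg (hg τ hτ) hb
    · exact .inl fun τ hτ => by rw [hβ τ hτ]; exact mul_nonneg_of_nonpos_of_nonpos (hg τ hτ) hb

/-- The remainder of the time integral is the integral of the remainders: nonnegative integrands
make it nonnegative at `t₀`, and nonpositive ones make it decrease from `t₀` to `t₁`. -/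
theorem integral_bregman_sign [CompleteSpace E] {T : ℝ} {J : ℝ → E → ℝ} {D : ℝ → E → E}
    (hJ : Continuous (Function.uncurry J)) (hD : Continuous (Function.uncurry D)) {p q : E}
    (hsign : (∀ τ ∈ Ioo 0 T, 0 ≤ J τ p - J τ q - inner ℝ (D τ q) (p - q)) ∨
      (∀ τ ∈ Ioo 0 T, J τ p - J τ q - inner ℝ (D τ q) (p - q) ≤ 0))
    {t₀ t₁ : ℝ} (h0 : 0 ≤ t₀) (h01 : t₀ ≤ t₁) (h1 : t₁ ≤ T) :
    0 ≤ (∫ τ in (0 : ℝ)..t₀, J τ p) - (∫ τ in (0 : ℝ)..t₀, J τ q) -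
        inner ℝ (∫ τ in (0 : ℝ)..t₀, D τ q) (p - q) ∨
      (∫ τ in (0 : ℝ)..t₁, J τ p) - (∫ τ in (0 : ℝ)..t₁, J τ q) -
          inner ℝ (∫ τ in (0 : ℝ)..t₁, D τ q) (p - q) ≤
        (∫ τ in (0 : ℝ)..t₀, J τ p) - (∫ τ in (0 : ℝ)..t₀, J τ q) -
          inner ℝ (∫ τ in (0 : ℝ)..t₀, D τ q) (p - q) := by
  have hJc : ∀ p, Continuous fun τ => J τ p := fun p =>
    hJ.comp (by fun_prop : Continuous fun τ => (τ, p))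
  have hDc : Continuous fun τ => D τ q := hD.comp (by fun_prop : Continuous fun τ => (τ, q))
  have hBc : Continuous fun τ => J τ p - J τ q - inner ℝ (D τ q) (p - q) :=
    ((hJc p).sub (hJc q)).sub (hDc.inner continuous_const)
  have hint : ∀ t, (∫ τ in (0 : ℝ)..t, J τ p) - (∫ τ in (0 : ℝ)..t, J τ q) -
      inner ℝ (∫ τ in (0 : ℝ)..t, D τ q) (p - q) =
      ∫ τ in (0 : ℝ)..t, (J τ p - J τ q - inner ℝ (D τ q) (p - q)) := fun t => by
    have hs₁ := intervalIntegral.integral_sub ((hJc p).intervalIntegrable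
      (μ := MeasureTheory.volume) 0 t) ((hJc q).intervalIntegrable 0 t)
    have hs₂ := intervalIntegral.integral_sub (((hJc p).sub (hJc q)).intervalIntegrable
      (μ := MeasureTheory.volume) 0 t)
      ((hDc.inner (continuous_const (y := p - q))).intervalIntegrable 0 t)
    simp only [Pi.sub_apply] at hs₂
    rw [hs₂, hs₁]
    have := ContinuousLinearMap.intervalIntegral_comp_comm (innerSL ℝ (p - q))
      (hDc.intervalIntegrable (μ := MeasureTheory.volume) 0 t)
    simp only [innerSL_apply_apply, real_inner_comm] at this ⊢
    rw [this]
  rw [hint, hint]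
  rcases hsign with h | h
  · left
    have := intervalIntegral.integral_mono_on_of_le_Ioo h0
      (continuous_const.intervalIntegrable (μ := MeasureTheory.volume) 0 t₀)
      (hBc.intervalIntegrable 0 t₀)
      (fun τ hτ => h τ ⟨hτ.1, hτ.2.trans_le (h01.trans h1)⟩)
    simpa using this
  · right
    have := intervalIntegral.integral_mono_on_of_le_Ioo h01 (hBc.intervalIntegrable t₀ t₁)
      (continuous_const.intervalIntegrable (μ := MeasureTheory.volume) t₀ t₁)
      (fun τ hτ => h τ ⟨h0.trans_lt hτ.1, hτ.2.trans_le h1⟩)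
    rw [intervalIntegral.integral_zero] at this
    rw [← intervalIntegral.integral_add_adjacent_intervals (hBc.intervalIntegrable 0 t₀)
      (hBc.intervalIntegrable t₀ t₁)]
    linarith

/-! ### Solving the characteristic equation variationally. -/

/-- If `U` has a subgradient of norm at most `K` everywhere and `F` has gradient `g`, then some
`q` is a subgradient, relative to a given ball around `x₀`, of `U` at `x₀ + g q`. Such a `q`
minimizes `W - F - ⟨x₀, ·⟩`, where `W` is the conjugate of the restriction of `U` to the ball. -/
theorem exists_subgradient_eq_add_gradient [ProperSpace E] {U F : E → ℝ} {g : E → E}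
    {K : NNReal} {ε : ℝ} {x₀ : E} (hU : ∀ x, ∃ r : E, ‖r‖ ≤ K ∧ ∀ z, U x + inner ℝ r (z - x) ≤ U z)
    (hF : ∀ q, HasFDerivAt F (innerSL ℝ (g q)) q) (hε : 0 < ε) :
    ∃ q, ‖q‖ ≤ K ∧ ∀ z ∈ Metric.closedBall x₀ ε,
      U (x₀ + g q) + inner ℝ q (z - (x₀ + g q)) ≤ U z := by
  have hUc : Continuous U := by
    refine (LipschitzWith.of_le_add_mul K fun x z => ?_).continuous
    obtain ⟨r, hr, hsub⟩ := hU x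
    have h1 := hsub z
    have h2 := (neg_le_abs _).trans (abs_real_inner_le_norm r (z - x))
    have h3 := mul_le_mul_of_nonneg_right hr (norm_nonneg (z - x))
    rw [dist_eq_norm, norm_sub_rev]
    linarith
  set B := Metric.closedBall x₀ ε
  have hB : IsCompact B := isCompact_closedBall x₀ ε
  have hBne : B.Nonempty := Metric.nonempty_closedBall.2 hε.le
  have hpair : Continuous (Function.uncurry fun q z : E => inner ℝ z q - U z) := by
    simp only [Function.uncurry_def]; fun_prop
  let W : E → ℝ := fun q => sSup ((fun z => inner ℝ z q - U z) '' B)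
  have hWc : Continuous W := hB.continuous_sSup hpair
  have hle : ∀ q, ∀ z ∈ B, inner ℝ z q - U z ≤ W q := fun q z hz =>
    le_csSup (hB.bddAbove_image (by fun_prop)) (mem_image_of_mem _ hz)
  have hWle : ∀ q a, (∀ z ∈ B, inner ℝ z q - U z ≤ a) → W q ≤ a := fun q a h =>
    csSup_le (hBne.image _) (by rintro _ ⟨z, hz, rfl⟩; exact h z hz)
  have hWconv : ConvexOn ℝ univ W := by
    refine ⟨convex_univ, fun p _ q _ a b ha hb hab => hWle _ _ fun z hz => ?_⟩
    have h1 := mul_le_mul_of_nonneg_left (hle p z hz) ha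
    have h2 := mul_le_mul_of_nonneg_left (hle q z hz) hb
    have h3 : U z = a * U z + b * U z := by rw [← add_mul, hab, one_mul]
    rw [inner_add_right, real_inner_smul_right, real_inner_smul_right, smul_eq_mul, smul_eq_mul]
    linarith
  have hFc : Continuous F := continuous_iff_continuousAt.2 fun q => (hF q).continuousAt
  obtain ⟨q, hq, hmin⟩ := (isCompact_closedBall (0 : E) K).exists_isMinOn
    (Metric.nonempty_closedBall.2 K.2)
    (by fun_prop : Continuous fun q => W q - (F q + innerSL ℝ x₀ q)).continuousOn
  have hqK : ‖q‖ ≤ K := by simpa using hq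
  refine ⟨q, hqK, ?_⟩
  have hgrad : HasFDerivAt (fun q => F q + innerSL ℝ x₀ q) (innerSL ℝ (x₀ + g q)) q := by
    rw [add_comm x₀, map_add]; exact (hF q).add (innerSL ℝ x₀).hasFDerivAt
  have hsub : ∀ p ∈ Metric.closedBall (0 : E) K, W q + inner ℝ (x₀ + g q) (p - q) ≤ W p :=
    fun p hp => convexOn_add_inner_le_of_isMinOn
      (hWconv.subset (subset_univ _) (convex_closedBall 0 _)) hq hgrad (fun p hp => hmin hp) hp
  -- The competitor `r` is admissible because `‖r‖ ≤ K`. It satisfies Fenchel's equality at `x₀ + g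
  -- q`, so the first-order condition at `q` tested on `r` gives `W q ≤ ⟨x₀ + g q, q⟩ - U (x₀ + g
  -- q)`, even if `x₀ + g q` lies outside the ball.
  obtain ⟨r, hr, hrsub⟩ := hU (x₀ + g q)
  have hWr : W r ≤ inner ℝ (x₀ + g q) r - U (x₀ + g q) := hWle _ _ fun z _ => by
    have := hrsub z
    rw [inner_sub_right, real_inner_comm, real_inner_comm (x₀ + g q)] at this
    linarith
  intro z hz
  have h1 := hsub r (by simpa using hr)
  have h2 := hle q z hz
  rw [inner_sub_right] at h1 ⊢
  rw [real_inner_comm z, real_inner_comm (x₀ + g q)]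
  linarith

/-! ### Stability of maximizers and Danskin's theorem. -/

theorem continuous_timeIntegral {X : Type*} [TopologicalSpace X] {J : ℝ → X → ℝ}
    (hJ : Continuous (Function.uncurry J)) (t : ℝ) :
    Continuous fun p => ∫ τ in (0 : ℝ)..t, J τ p :=
  intervalIntegral.continuous_parametric_intervalIntegral_of_continuous' (f := fun p τ => J τ p)
    (hJ.comp continuous_swap) 0 t

/-- Maximizers at nearby points are close to a unique maximizer. -/
theorem eventually_isMaximizer_norm_sub_lt [ProperSpace E] {σ : E → ℝ} {K : NNReal}
    {J : ℝ → E → ℝ} {t₀ : ℝ} {x₀ q : E} (hLip : LipschitzWith K σ)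
    (hJ : Continuous (Function.uncurry J)) (hq : q ∈ effDomain σ)
    (huniq : ∀ p ∈ effDomain σ, p ≠ q →
      objective σ (fun p => ∫ τ in (0 : ℝ)..t₀, J τ p) x₀ p <
        objective σ (fun p => ∫ τ in (0 : ℝ)..t₀, J τ p) x₀ q) {η : ℝ} (hη : 0 < η) :
    ∀ᶠ z : ℝ × E in 𝓝 (t₀, x₀), ∀ p,
      IsMaximizer σ (fun p => ∫ τ in (0 : ℝ)..z.1, J τ p) z.2 p → ‖p - q‖ < η := by
  set C : Set E := Metric.closedBall 0 K \ Metric.ball q η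
  have hC : IsCompact C := (isCompact_closedBall 0 _).diff Metric.isOpen_ball
  have hmemC : ∀ p ∈ effDomain σ, ¬ ‖p - q‖ < η → p ∈ C := fun p hp hpq =>
    ⟨by simpa using norm_le_of_mem_effDomain hLip hp, by simpa [dist_eq_norm] using hpq⟩
  by_cases hne : ∃ p₀ ∈ C, p₀ ∈ effDomain σ
  swap
  · refine .of_forall fun z p hp => ?_
    by_contra hpq
    exact hne ⟨p, hmemC p hp.1 hpq, hp.1⟩
  obtain ⟨p₀, hp₀, hp₀'⟩ := hne
  obtain ⟨m, hmC, hm, hmin⟩ := exists_isMinOn_of_mem_effDomain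
    (c := fun p => (∫ τ in (0 : ℝ)..t₀, J τ p) - inner ℝ x₀ p) hC
    ((continuous_timeIntegral hJ t₀).sub (by fun_prop)) hp₀ hp₀'
  have hmq : m ≠ q := by
    rintro rfl
    exact hmC.2 (Metric.mem_ball_self hη)
  have hgap := huniq m hm hmq
  -- `Ψ` is the objective without `σ*`. It is jointly continuous, and `σ*` cancels when one momentum
  -- is compared at two base points.
  let Ψ : ℝ × E → E → ℝ := fun z p => inner ℝ z.2 p - ∫ τ in (0 : ℝ)..z.1, J τ p
  have hΨ : Continuous fun w : (ℝ × E) × E => Ψ w.1 w.2 := by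
    refine Continuous.sub (by fun_prop) ?_
    exact intervalIntegral.continuous_parametric_intervalIntegral_of_continuous
      (f := fun (w : (ℝ × E) × E) τ => J τ w.2)
      (hJ.comp (by fun_prop : Continuous fun v : ((ℝ × E) × E) × ℝ => (v.2, v.1.2)))
      (by fun_prop : Continuous fun w : (ℝ × E) × E => w.1.1)
  have hev : ∀ᶠ z : ℝ × E in 𝓝 (t₀, x₀), ∀ p ∈ C,
      Ψ z p - Ψ (t₀, x₀) p - (Ψ z q - Ψ (t₀, x₀) q) <
        objective σ (fun p => ∫ τ in (0 : ℝ)..t₀, J τ p) x₀ q -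
          objective σ (fun p => ∫ τ in (0 : ℝ)..t₀, J τ p) x₀ m := by
    refine hC.eventually_forall_of_forall_eventually fun p _ => ?_
    have hc : Continuous fun w : (ℝ × E) × E =>
        Ψ w.1 w.2 - Ψ (t₀, x₀) w.2 - (Ψ w.1 q - Ψ (t₀, x₀) q) :=
      ((hΨ.sub (hΨ.comp (by fun_prop : Continuous fun w : (ℝ × E) × E => ((t₀, x₀), w.2)))).sub
        ((hΨ.comp (by fun_prop : Continuous fun w : (ℝ × E) × E => (w.1, q))).sub
          continuous_const))
    refine hc.continuousAt.eventually_lt continuousAt_const ?_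
    simpa using hgap
  filter_upwards [hev] with z hz p hp
  by_contra hpq
  have hpC := hmemC p hp.1 hpq
  have h1 := hz p hpC
  have h2 := hp.2 q hq
  have h3 := hmin p hpC hp.1
  simp only [objective, Ψ] at h1 h2 h3
  linarith

/-- Danskin's theorem for the Hopf formula at a point with a unique maximizer. -/
theorem hasFDerivAt_of_unique_isMaximizer [ProperSpace E] {σ : E → ℝ} {K : NNReal}
    {J : ℝ → E → ℝ} {u : ℝ × E → ℝ} {t₀ : ℝ} {x₀ q : E} (hLip : LipschitzWith K σ)
    (hJ : Continuous (Function.uncurry J)) (hq : q ∈ effDomain σ)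
    (huniq : ∀ p ∈ effDomain σ, p ≠ q →
      objective σ (fun p => ∫ τ in (0 : ℝ)..t₀, J τ p) x₀ p <
        objective σ (fun p => ∫ τ in (0 : ℝ)..t₀, J τ p) x₀ q)
    (hu : ∀ᶠ z : ℝ × E in 𝓝 (t₀, x₀), ∃ p,
      IsMaximizer σ (fun p => ∫ τ in (0 : ℝ)..z.1, J τ p) z.2 p ∧
        u z = objective σ (fun p => ∫ τ in (0 : ℝ)..z.1, J τ p) z.2 p) :
    HasFDerivAt u ((innerSL ℝ q).comp (ContinuousLinearMap.snd ℝ ℝ E) -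
      J t₀ q • ContinuousLinearMap.fst ℝ ℝ E) (t₀, x₀) := by
  have hJc : ∀ p, Continuous fun τ => J τ p := fun p =>
    hJ.comp (by fun_prop : Continuous fun τ => (τ, p))
  have hmax : ∀ p ∈ effDomain σ,
      objective σ (fun p => ∫ τ in (0 : ℝ)..t₀, J τ p) x₀ p ≤
        objective σ (fun p => ∫ τ in (0 : ℝ)..t₀, J τ p) x₀ q := fun p hp => by
    by_cases hpq : p = q
    · rw [hpq]
    · exact (huniq p hp hpq).le
  have hu₀ : u (t₀, x₀) = objective σ (fun p => ∫ τ in (0 : ℝ)..t₀, J τ p) x₀ q := by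
    obtain ⟨p, hp, hup⟩ := hu.self_of_nhds
    rw [hup]
    exact le_antisymm (hmax p hp.1) (hp.2 q hq)
  refine .of_isLittleO (Asymptotics.isLittleO_iff.2 fun c hc => ?_)
  obtain ⟨η, hη, hJη⟩ := Metric.continuousAt_iff.1 (hJ.continuousAt (x := (t₀, q)))
    (c / 2) (half_pos hc)
  have hint : ∀ t p, |t - t₀| < η → ‖p - q‖ < η →
      |(∫ τ in (0 : ℝ)..t, J τ p) - (∫ τ in (0 : ℝ)..t₀, J τ p) - (t - t₀) * J t₀ q| ≤
        c / 2 * |t - t₀| := fun t p ht hp => by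
    have h1 : (∫ τ in (0 : ℝ)..t, J τ p) - (∫ τ in (0 : ℝ)..t₀, J τ p) - (t - t₀) * J t₀ q =
        ∫ τ in t₀..t, (J τ p - J t₀ q) := by
      rw [intervalIntegral.integral_sub ((hJc p).intervalIntegrable _ _)
        intervalIntegrable_const, intervalIntegral.integral_const, smul_eq_mul,
        intervalIntegral.integral_interval_sub_left ((hJc p).intervalIntegrable _ _)
          ((hJc p).intervalIntegrable _ _)]
    rw [h1, ← Real.norm_eq_abs]
    refine intervalIntegral.norm_integral_le_of_norm_le_const fun τ hτ => ?_
    have hτ' : |τ - t₀| < η := (abs_sub_left_of_mem_uIcc (uIoc_subset_uIcc hτ)).trans_lt ht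
    have := hJη (x := (τ, p)) (by
      rw [Prod.dist_eq]
      exact max_lt (by rwa [Real.dist_eq]) (by rwa [dist_eq_norm]))
    rw [Real.dist_eq] at this
    exact this.le
  have hnear : ∀ᶠ z : ℝ × E in 𝓝 (t₀, x₀), |z.1 - t₀| < η := by
    have : Continuous fun z : ℝ × E => |z.1 - t₀| := by fun_prop
    exact this.continuousAt.eventually_lt continuousAt_const (by simpa using hη)
  filter_upwards [hu, hnear, eventually_isMaximizer_norm_sub_lt hLip hJ hq huniq
    (lt_min hη (half_pos hc))] with z hz hzt hzq
  obtain ⟨p, hp, hup⟩ := hz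
  have hpq := lt_min_iff.1 (hzq p hp)
  have h1 := abs_le.1 (hint z.1 p hzt hpq.1)
  have h2 := abs_le.1 (hint z.1 q hzt (by simpa using hη))
  -- Two-sided estimate: testing `q` at `z` bounds `u z` below, testing `p` at `(t₀, x₀)` bounds it
  -- above. The time and space errors each cost at most `c / 2` times the distance.
  have h3 := hp.2 q hq
  have h4 := hmax p hp.1
  have h5 : inner ℝ (z.2 - x₀) (p - q) ≤ c / 2 * ‖z.2 - x₀‖ := by
    refine (real_inner_le_norm _ _).trans ?_
    rw [mul_comm]
    exact mul_le_mul_of_nonneg_right hpq.2.le (norm_nonneg _)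
  have h6 : |z.1 - t₀| ≤ ‖z - (t₀, x₀)‖ := norm_fst_le (z - (t₀, x₀))
  have h7 : ‖z.2 - x₀‖ ≤ ‖z - (t₀, x₀)‖ := norm_snd_le (z - (t₀, x₀))
  have h8 := mul_le_mul_of_nonneg_left h6 (half_pos hc).le
  have h9 := mul_le_mul_of_nonneg_left h7 (half_pos hc).le
  have h10 := mul_nonneg (half_pos hc).le (norm_nonneg (z.2 - x₀))
  have hlin : ((innerSL ℝ q).comp (ContinuousLinearMap.snd ℝ ℝ E) -
      J t₀ q • ContinuousLinearMap.fst ℝ ℝ E) (z - (t₀, x₀)) =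
      inner ℝ z.2 q - inner ℝ x₀ q - (z.1 - t₀) * J t₀ q := by
    simp [inner_sub_right, real_inner_comm, mul_comm]
  rw [hlin, hup, hu₀, Real.norm_eq_abs, abs_le]
  simp only [objective, inner_sub_left, inner_sub_right] at h3 h4 h5 ⊢
  constructor <;> linarith [h1.1, h1.2, h2.1, h2.2]

/-! ### Application to the Hopf formula. -/

section

variable {n : ℕ} {T : ℝ} {H J : ℝ → EuclideanSpace ℝ (Fin n) → ℝ}
  {σ : EuclideanSpace ℝ (Fin n) → ℝ} {K : NNReal}

theorem hopf_eq_objective (hJH : ∀ τ ∈ Icc 0 T, J τ = H τ) {t : ℝ} (ht : t ∈ Icc 0 T)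
    {x q : EuclideanSpace ℝ (Fin n)}
    (hq : IsMaximizer σ (fun p => ∫ τ in (0 : ℝ)..t, J τ p) x q) :
    hopf H σ t x = objective σ (fun p => ∫ τ in (0 : ℝ)..t, J τ p) x q := by
  have h : (fun p => ∫ τ in (0 : ℝ)..t, J τ p) = fun p => ∫ τ in (0 : ℝ)..t, H τ p := by
    funext p
    refine intervalIntegral.integral_congr fun τ hτ => ?_
    rw [uIcc_of_le ht.1] at hτ
    exact congrFun (hJH τ ⟨hτ.1, hτ.2.trans ht.2⟩) p
  rw [h] at hq ⊢
  exact hopf_eq_of_isMaximizer hq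

/-- Maximizers are spatial subgradients of the Hopf formula. -/
theorem IsMaximizer.hopf_add_inner_le (hJ : Continuous (Function.uncurry J))
    (hσ : ConvexOn ℝ univ σ) (hdiff : Differentiable ℝ σ) (hLip : LipschitzWith K σ)
    (hJH : ∀ τ ∈ Icc 0 T, J τ = H τ) {t : ℝ} (ht : t ∈ Icc 0 T)
    {x q : EuclideanSpace ℝ (Fin n)}
    (hq : IsMaximizer σ (fun p => ∫ τ in (0 : ℝ)..t, J τ p) x q)
    (z : EuclideanSpace ℝ (Fin n)) : hopf H σ t x + inner ℝ q (z - x) ≤ hopf H σ t z := by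
  obtain ⟨p, hp⟩ := exists_isMaximizer hσ hdiff hLip (continuous_timeIntegral hJ t) z
  rw [hopf_eq_objective hJH ht hq, hopf_eq_objective hJH ht hp]
  have := hp.2 q hq.1
  simp only [objective] at this ⊢
  rw [inner_sub_right, real_inner_comm z, real_inner_comm x]
  linarith

theorem differentiableAt_hopf_of_unique (hJ : Continuous (Function.uncurry J))
    (hσ : ConvexOn ℝ univ σ) (hdiff : Differentiable ℝ σ) (hLip : LipschitzWith K σ)
    (hJH : ∀ τ ∈ Icc 0 T, J τ = H τ) {t : ℝ} (ht : t ∈ Ioo 0 T)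
    {x q : EuclideanSpace ℝ (Fin n)} (hq : q ∈ effDomain σ)
    (huniq : ∀ p ∈ effDomain σ, p ≠ q →
      objective σ (fun p => ∫ τ in (0 : ℝ)..t, J τ p) x p <
        objective σ (fun p => ∫ τ in (0 : ℝ)..t, J τ p) x q) :
    DifferentiableAt ℝ (fun z : ℝ × EuclideanSpace ℝ (Fin n) => hopf H σ z.1 z.2) (t, x) := by
  refine (hasFDerivAt_of_unique_isMaximizer hLip hJ hq huniq ?_).differentiableAt
  filter_upwards [continuous_fst.continuousAt.preimage_mem_nhds (isOpen_Ioo.mem_nhds ht)]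
    with z hz
  obtain ⟨p, hp⟩ := exists_isMaximizer hσ hdiff hLip (continuous_timeIntegral hJ z.1) z.2
  exact ⟨p, hp, hopf_eq_objective hJH (Ioo_subset_Icc_self hz) hp⟩

end

end

end HopfFormula

/-! ### Propagation of singularities. -/

theorem theorem3p6 (n : ℕ) (T : ℝ) (hT : 0 < T)
    (H : ℝ → EuclideanSpace ℝ (Fin n) → ℝ) (σ : EuclideanSpace ℝ (Fin n) → ℝ)
    (hH : ContDiffOn ℝ 1 (fun z : ℝ × EuclideanSpace ℝ (Fin n) => H z.1 z.2)
      (Set.Icc 0 T ×ˢ Set.univ))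
    (hσ : ContDiff ℝ 1 σ) (hconv : ConvexOn ℝ Set.univ σ)
    (hA1 : HopfFormula.A1 T H σ) (hA2 : HopfFormula.A2 T H)
    (hLip : ∃ K : NNReal, LipschitzWith K σ) :
    ∀ ε > (0 : ℝ), ∃ δ > (0 : ℝ), ∀ (t₀ : ℝ) (x₀ : EuclideanSpace ℝ (Fin n)),
      HopfFormula.IsSingular T H σ t₀ x₀ →
        ∀ t₁ ∈ Set.Icc t₀ (t₀ + δ), t₁ < T →
          ∃ x₁ ∈ Metric.closedBall x₀ ε, HopfFormula.IsSingular T H σ t₁ x₁ := by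
  open HopfFormula in
  intro ε hε
  obtain ⟨K, hK⟩ := hLip
  have hdiff : Differentiable ℝ σ := hσ.differentiable one_ne_zero
  obtain ⟨J, D, hJ, hD, hJD, hJH⟩ := exists_hamiltonian_extension hT hH
  have hDc : ∀ p, Continuous fun τ => D τ p := fun p =>
    hD.comp (by fun_prop : Continuous fun τ => (τ, p))
  obtain ⟨M, hM⟩ := ((isCompact_Icc (a := 0) (b := T)).prod
    (isCompact_closedBall (0 : EuclideanSpace ℝ (Fin n)) K)).exists_bound_of_continuousOn
    (s := Icc 0 T ×ˢ Metric.closedBall 0 K) hD.continuousOn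
  have hM1 : 0 < |M| + 1 := by positivity
  -- `M` bounds the speeds on `[0, T]` times the ball of radius `K`; `|M| + 1` is a positive
  -- divisor, and the factor `1 / 2` keeps `x₀ + v` in the open ball.
  refine ⟨ε / 2 / (|M| + 1), by positivity, ?_⟩
  rintro t₀ x₀ ⟨ht₀, hsing⟩ t₁ ⟨h01, h1δ⟩ ht₁T
  have ht₁ : t₁ ∈ Ioo 0 T := ⟨ht₀.1.trans_le h01, ht₁T⟩
  have ht₁' := Ioo_subset_Icc_self ht₁
  by_contra! hreg
  have hspace : ∀ x ∈ Metric.closedBall x₀ ε, DifferentiableAt ℝ (hopf H σ t₁) x := by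
    intro x hx
    have h : DifferentiableAt ℝ
        (fun z : ℝ × EuclideanSpace ℝ (Fin n) => hopf H σ z.1 z.2) (t₁, x) := by
      by_contra h
      exact hreg x hx ⟨ht₁, h⟩
    exact h.comp x (f := fun x => (t₁, x)) (by fun_prop)
  have hmax := fun x => exists_isMaximizer hconv hdiff hK (continuous_timeIntegral hJ t₁) x
  obtain ⟨q, hqK, hq⟩ := exists_subgradient_eq_add_gradient (x₀ := x₀)
    (U := hopf H σ t₁) (K := K) (fun x => by
      obtain ⟨r, hr⟩ := hmax x
      exact ⟨r, norm_le_of_mem_effDomain hK hr.1,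
        hr.hopf_add_inner_le hJ hconv hdiff hK hJH ht₁'⟩)
    (fun q => hasFDerivAt_intervalIntegral hJ hD hJD t₀ t₁ q) hε
  set v := ∫ τ in t₀..t₁, D τ q with hv
  have hvlt : ‖v‖ < ε := by
    have h1 : ‖v‖ ≤ (|M| + 1) * |t₁ - t₀| := by
      refine intervalIntegral.norm_integral_le_of_norm_le_const fun τ hτ => ?_
      rw [uIoc_of_le h01] at hτ
      have := hM (τ, q) ⟨⟨(ht₀.1.trans hτ.1).le, hτ.2.trans ht₁T.le⟩, by simpa using hqK⟩
      exact this.trans (by linarith [le_abs_self M])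
    rw [abs_of_nonneg (sub_nonneg.2 h01)] at h1
    have h2 : (|M| + 1) * (t₁ - t₀) ≤ ε / 2 := by
      rw [mul_comm, ← le_div_iff₀ hM1]; linarith
    linarith
  have hball : x₀ + v ∈ Metric.ball x₀ ε := by simpa using hvlt
  obtain ⟨w, hw⟩ := hasFDerivAt_innerSL_of_differentiableAt
    (hspace (x₀ + v) (Metric.ball_subset_closedBall hball))
  -- `q` is a subgradient only relative to the ball, which suffices since `x₀ + v` is interior.
  have hqw : q = w := eq_of_hasFDerivAt_of_eventually_le hw <| by
    filter_upwards [Metric.isOpen_ball.mem_nhds hball] with z hz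
    exact hq z (Metric.ball_subset_closedBall hz)
  have heq : ∀ p, IsMaximizer σ (fun p => ∫ τ in (0 : ℝ)..t₁, J τ p) (x₀ + v) p → p = q :=
    fun p hp => hqw ▸ eq_of_hasFDerivAt_of_eventually_le hw
      (.of_forall (hp.hopf_add_inner_le hJ hconv hdiff hK hJH ht₁'))
  obtain ⟨r, hr⟩ := hmax (x₀ + v)
  obtain rfl := heq r hr
  refine hsing (differentiableAt_hopf_of_unique hJ hconv hdiff hK hJH ht₀ hr.1
    fun p hp hpq => ?_)
  refine hr.backward hconv hdiff (hasFDerivAt_intervalIntegral hJ hD hJD 0 t₁ r)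
    (g₀ := ∫ τ in (0 : ℝ)..t₀, D τ r) ?_ (fun p hp hpq => ?_) (fun p => ?_) hp hpq
  · rw [intervalIntegral.integral_interval_sub_left ((hDc r).intervalIntegrable _ _)
      ((hDc r).intervalIntegrable _ _), ← hv, add_sub_cancel_right]
  · refine lt_of_le_of_ne (hr.2 p hp) fun h => hpq (heq p ⟨hp, fun p' hp' => ?_⟩)
    rw [h]
    exact hr.2 p' hp'
  · exact integral_bregman_sign hJ hD (hA2.bregman_sign hJD hJH p r) ht₀.1.le h01 ht₁T.le
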